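/- **Setting.** Let $\mathit{Agts}$ be a finite set of agents and $\mathit{AP}$ a finite set of atomic propositions. A concurrent game structure (CGS) is a tuple $\mathcal{G}=(S,s_0,\mathbb{A},\kappa,L)$ with a finite set $S$ of states, an initial state $s_0\in S$, a finite non-empty set $\mathbb{A}$ of actions, a transition function $\kappa:S\times(\mathit{Agts}\to\mathbb{A})\to S$ and a labeling $L:S\to 2^{\mathit{AP}}$. A strategy is a function $f:S^+\to\mathbb{A}$. For a state $s$ and strategies $(f_i)_{i\in\mathit{Agts}}$, $\mathrm{Play}(s,(f_i)_i)$ is the unique $p\in S^\omega$ with $p(0)=s$ and $p(j+1)=\kappa\big(p(j),(f_i(p[0,j]))_{i}\big)$ for all $j$. HyperSL path formulas $\psi$ and state formulas $\varphi$ over a countably infinite set of strategy variables $x$ and a countably infinite set of path variables $\pi$ are given by $$\psi ::= a_\pi \mid \varphi_\pi \mid \psi\wedge\psi \mid \neg\psi \mid \mathsf{X}\,\psi \mid \psi\,\mathsf{U}\,\psi,\qquad \varphi ::= \forall x.\,\varphi \mid \exists x.\,\varphi \mid \psi[\pi_1:\vec{x}_1,\dots,\pi_m:\vec{x}_m],$$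 where $a\in\mathit{AP}$ and each $\vec{x}_k$ maps agents to strategy variables. In $\psi[\pi_1:\vec{x}_1,\dots,\pi_m:\vec{x}_m]$ the $\pi_k$ are distinct and include all path variables that occur free in $\psi$ (the variable $\pi$ in $a_\pi$ and $\varphi_\pi$ is free), and nested state formulas are closed (no free strategy variables). Path formulas are evaluated in partial maps $\Pi$ from path variables to $S^\omega$: $\Pi\models a_\pi$ iff $a\in L(\Pi(\pi)(0))$; $\Pi\models\varphi_\pi$ iff $\Pi(\pi)(0),\{\}\models\varphi$; and $\neg,\wedge,\mathsf{X},\mathsf{U}$ are interpreted as in LTL, all paths of $\Pi$ being shifted synchronously. State formulas are evaluated in a state $s$ and a partial map $\Delta$ from strategy variables to strategies: $\forall x$ and $\exists x$ range over all strategies in $\mathcal{G}$, and $s,\Delta\models\psi[\pi_k:\vec{x}_k]_{k=1}^m$ iff $\big[\pi_k\mapsto\mathrm{Play}(s,(\Delta(\vec{x}_k(i)))_{i})\big]_{k=1}^m\models\psi$. For closed $\varphi$, $\mathcal{G}\models\varphi$ means $s_0,\{\}\models\varphi$. **Corollary.** Model checking of HyperSL is undecidable: there is no algorithm that, given finite sets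 $\mathit{Agts}$ and $\mathit{AP}$, a CGS $\mathcal{G}$ over them and a closed HyperSL formula $\varphi$ over them, decides whether $\mathcal{G}\models\varphi$. The problem is also undecidable with $\mathit{Agts}$ and $\mathit{AP}$ fixed, for some finite sets $\mathit{Agts}$ and $\mathit{AP}$. -/

import Mathlib

namespace HyperSL

/-! Concurrent game structures, strategies and plays -/

/-- A concurrent game structure over agents `Agts`, propositions `AP`, states `S`, actions `Act`
(all of them are finite in the model-checking problem below). -/
structure CGS (Agts AP S Act : Type) where
  init : S
  trans : S → (Agts → Act) → S
  label : S → Finset AP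

/-- The set `X⁺` of non-empty finite sequences. -/
abbrev Plus (X : Type) : Type := {u : List X // u ≠ []}

/-- A strategy `S⁺ → Act`. -/
abbrev Strategy (S Act : Type) : Type := Plus S → Act

/-- The finite prefix `p[0,j]`, of length `j + 1`, of an infinite sequence. -/
def pref {S : Type} (p : ℕ → S) (j : ℕ) : Plus S :=
  ⟨List.ofFn (fun i : Fin (j + 1) => p i), by simp⟩

/-- The infinite suffix `p[j,∞]`. -/
def suffix {S : Type} (p : ℕ → S) (j : ℕ) : ℕ → S := fun k => p (j + k)

variable {Agts AP S Act : Type}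

/-- The history after `j` steps when the agents play the profile `f` from the state `s`. -/
def CGS.hist (G : CGS Agts AP S Act) (s : S) (f : Agts → Strategy S Act) : ℕ → Plus S
  | 0 => ⟨[s], by simp⟩
  | j + 1 =>
    let h := G.hist s f j
    ⟨h.1 ++ [G.trans (h.1.getLast h.2) (fun i => f i h)], by simp⟩

/-- The unique path that results from the profile `f` in the state `s`. -/
def CGS.play (G : CGS Agts AP S Act) (s : S) (f : Agts → Strategy S Act) : ℕ → S :=
  fun j => (G.hist s f j).1.getLast (G.hist s f j).2

theorem CGS.play_zero (G : CGS Agts AP S Act) (s : S) (f : Agts → Strategy S Act) :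
    G.play s f 0 = s := by
  simp [CGS.play, CGS.hist]

theorem CGS.pref_play (G : CGS Agts AP S Act) (s : S) (f : Agts → Strategy S Act) (j : ℕ) :
    pref (G.play s f) j = G.hist s f j := by
  induction j with
  | zero => simp [pref, CGS.play_zero, CGS.hist]
  | succ j ih =>
    have h1 : List.ofFn (fun i : Fin (j + 1) => G.play s f i) = (G.hist s f j).1 :=
      congrArg Subtype.val ih
    apply Subtype.ext
    change List.ofFn (fun i : Fin (j + 1 + 1) => G.play s f i) = _
    rw [List.ofFn_succ_last]
    simp only [Fin.val_castSucc, h1, Fin.val_last]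
    simp [CGS.play, CGS.hist]

theorem CGS.play_succ (G : CGS Agts AP S Act) (s : S) (f : Agts → Strategy S Act) (j : ℕ) :
    G.play s f (j + 1) = G.trans (G.play s f j) (fun i => f i (pref (G.play s f) j)) := by
  rw [CGS.pref_play]
  simp [CGS.play, CGS.hist]

/-! Syntax; strategy variables and path variables are both drawn from `ℕ` -/

mutual

/-- Path formulas `ψ ::= a_π | φ_π | ψ ∧ ψ | ¬ψ | X ψ | ψ U ψ`. -/
inductive PathFormula (Agts AP : Type) : Type
  | atom (a : AP) (π : ℕ) : PathFormula Agts AP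
  | nested (φ : StateFormula Agts AP) (π : ℕ) : PathFormula Agts AP
  | and (ψ₁ ψ₂ : PathFormula Agts AP) : PathFormula Agts AP
  | neg (ψ : PathFormula Agts AP) : PathFormula Agts AP
  | next (ψ : PathFormula Agts AP) : PathFormula Agts AP
  | untl (ψ₁ ψ₂ : PathFormula Agts AP) : PathFormula Agts AP

/-- State formulas `φ ::= ∀x. φ | ∃x. φ | ψ[π₁ : x₁, …, πₘ : xₘ]`; the bindings `πₖ : xₖ` form a
list of pairs of a path variable and a map from agents to strategy variables. -/
inductive StateFormula (Agts AP : Type) : Type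
  | all (x : ℕ) (φ : StateFormula Agts AP) : StateFormula Agts AP
  | ex (x : ℕ) (φ : StateFormula Agts AP) : StateFormula Agts AP
  | bind (ψ : PathFormula Agts AP) (b : List (ℕ × (Agts → ℕ))) : StateFormula Agts AP

end

/-- Free path variables of a path formula. -/
def PathFormula.pathVars : PathFormula Agts AP → Set ℕ
  | .atom _ π => {π}
  | .nested _ π => {π}
  | .and ψ₁ ψ₂ => ψ₁.pathVars ∪ ψ₂.pathVars
  | .neg ψ => ψ.pathVars
  | .next ψ => ψ.pathVars
  | .untl ψ₁ ψ₂ => ψ₁.pathVars ∪ ψ₂.pathVars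

/-- Free strategy variables of a state formula. (State formulas nested in `ψ` contribute none:
they are required to be closed in `StateFormula.WF`.) -/
def StateFormula.freeVars : StateFormula Agts AP → Set ℕ
  | .all x φ => φ.freeVars \ {x}
  | .ex x φ => φ.freeVars \ {x}
  | .bind _ b => {x | ∃ p ∈ b, ∃ i, p.2 i = x}

/-- A state formula is closed if it has no free strategy variable. -/
def StateFormula.Closed (φ : StateFormula Agts AP) : Prop := φ.freeVars = ∅

mutual

/-- All nested state formulas are well-formed and closed. -/
def PathFormula.WF : PathFormula Agts AP → Prop
  | .atom _ _ => True
  | .nested φ _ => φ.WF ∧ φ.Closed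
  | .and ψ₁ ψ₂ => ψ₁.WF ∧ ψ₂.WF
  | .neg ψ => ψ.WF
  | .next ψ => ψ.WF
  | .untl ψ₁ ψ₂ => ψ₁.WF ∧ ψ₂.WF

/-- In `ψ[π₁ : x₁, …, πₘ : xₘ]`, the `πₖ` are distinct and include all path variables of `ψ`. -/
def StateFormula.WF : StateFormula Agts AP → Prop
  | .all _ φ => φ.WF
  | .ex _ φ => φ.WF
  | .bind ψ b => ψ.WF ∧ (b.map Prod.fst).Nodup ∧ ∀ π ∈ ψ.pathVars, π ∈ b.map Prod.fst

end

/-! Semantics; partial maps are functions into `Option` -/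

/-- Strategy assignments `Δ : 𝒳 ⇀ Str(G)`. -/
abbrev StratAssign (S Act : Type) : Type := ℕ → Option (Strategy S Act)

/-- Path assignments `Π : 𝒱 ⇀ S^ω`. -/
abbrev PathAssign (S : Type) : Type := ℕ → Option (ℕ → S)

/-- The shifted assignment `Π[j,∞]`. -/
def PathAssign.shift (P : PathAssign S) (j : ℕ) : PathAssign S :=
  fun π => (P π).map (fun p => suffix p j)

open Classical in
/-- The profile of strategies that `Δ` assigns to the variables `x i`, if all are defined. -/
noncomputable def StratAssign.profile (Δ : StratAssign S Act) (x : Agts → ℕ) :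
    Option (Agts → Strategy S Act) :=
  if h : ∀ i, (Δ (x i)).isSome then some (fun i => (Δ (x i)).get (h i)) else none

/-- The path assignment that maps each `πₖ` of the list `b` to the play from `s` in which every
agent `i` plays the strategy `Δ (xₖ i)`. -/
noncomputable def CGS.bindPaths (G : CGS Agts AP S Act) (s : S) (Δ : StratAssign S Act)
    (b : List (ℕ × (Agts → ℕ))) : PathAssign S :=
  fun π => (b.lookup π).bind (fun x => (Δ.profile x).map (fun f => G.play s f))

mutual

/-- `P ⊨_G ψ`. -/
def PathFormula.Sat (G : CGS Agts AP S Act) : PathFormula Agts AP → PathAssign S → Prop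
  | .atom a π, P => ∃ p, P π = some p ∧ a ∈ G.label (p 0)
  | .nested φ π, P => ∃ p, P π = some p ∧ φ.Sat G (p 0) (fun _ => none)
  | .and ψ₁ ψ₂, P => ψ₁.Sat G P ∧ ψ₂.Sat G P
  | .neg ψ, P => ¬ ψ.Sat G P
  | .next ψ, P => ψ.Sat G (P.shift 1)
  | .untl ψ₁ ψ₂, P => ∃ j, ψ₂.Sat G (P.shift j) ∧ ∀ k < j, ψ₁.Sat G (P.shift k)

/-- `s, Δ ⊨_G φ`. -/
def StateFormula.Sat (G : CGS Agts AP S Act) :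
    StateFormula Agts AP → S → StratAssign S Act → Prop
  | .all x φ, s, Δ => ∀ f : Strategy S Act, φ.Sat G s (Function.update Δ x (some f))
  | .ex x φ, s, Δ => ∃ f : Strategy S Act, φ.Sat G s (Function.update Δ x (some f))
  | .bind ψ b, s, Δ => ψ.Sat G (G.bindPaths s Δ b)

end

/-- `G ⊨ φ`. -/
def CGS.Models (G : CGS Agts AP S Act) (φ : StateFormula Agts AP) : Prop :=
  φ.Sat G G.init (fun _ => none)

/-! The model-checking problem -/

/-- A model-checking instance with `n` agents and `m` atomic propositions: a finite game structure
with a non-empty set of actions, and a closed well-formed state formula. -/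
structure MCInstance (n m : ℕ) where
  numStates : ℕ
  numActions : ℕ
  actions_pos : 0 < numActions
  game : CGS (Fin n) (Fin m) (Fin numStates) (Fin numActions)
  formula : StateFormula (Fin n) (Fin m)
  wf : formula.WF
  closed : formula.Closed

/-- The question asked of an instance. -/
def MCInstance.Holds {n m : ℕ} (I : MCInstance n m) : Prop := I.game.Models I.formula

/-- The list of bindings `πₖ : xₖ`, each profile being listed as `[xₖ 0, …, xₖ (n - 1)]`. -/
def codeBindings {n : ℕ} (b : List (ℕ × (Fin n → ℕ))) : ℕ :=
  Encodable.encode (b.map (fun p => (p.1, List.ofFn p.2)))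

mutual

/-- Gödel numbering of path formulas: a tag, paired with the codes of the components. -/
def PathFormula.code {n m : ℕ} : PathFormula (Fin n) (Fin m) → ℕ
  | .atom a π => Nat.pair 0 (Nat.pair a π)
  | .nested φ π => Nat.pair 1 (Nat.pair φ.code π)
  | .and ψ₁ ψ₂ => Nat.pair 2 (Nat.pair ψ₁.code ψ₂.code)
  | .neg ψ => Nat.pair 3 ψ.code
  | .next ψ => Nat.pair 4 ψ.code
  | .untl ψ₁ ψ₂ => Nat.pair 5 (Nat.pair ψ₁.code ψ₂.code)

/-- Gödel numbering of state formulas. -/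
def StateFormula.code {n m : ℕ} : StateFormula (Fin n) (Fin m) → ℕ
  | .all x φ => Nat.pair 0 (Nat.pair x φ.code)
  | .ex x φ => Nat.pair 1 (Nat.pair x φ.code)
  | .bind ψ b => Nat.pair 2 (Nat.pair ψ.code (codeBindings b))

end

/-- The transition table: for every state, the list of its successors under all action profiles. -/
def CGS.transTable {n m k l : ℕ} (G : CGS (Fin n) (Fin m) (Fin k) (Fin l)) : List (List ℕ) :=
  List.ofFn fun s : Fin k => List.ofFn fun a : Fin (l ^ n) =>
    (G.trans s (finFunctionFinEquiv.symm a) : ℕ)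

/-- The labeling table: for every state, the truth values of all propositions. -/
def CGS.labelTable {n m k l : ℕ} (G : CGS (Fin n) (Fin m) (Fin k) (Fin l)) : List (List Bool) :=
  List.ofFn fun s : Fin k => List.ofFn fun a : Fin m => decide (a ∈ G.label s)

/-- The natural number that represents an instance as an input of an algorithm. -/
def MCInstance.code {n m : ℕ} (I : MCInstance n m) : ℕ :=
  Encodable.encode (I.numStates, I.numActions, (I.game.init : ℕ), I.game.transTable,
    I.game.labelTable, I.formula.code)

theorem codeBindings_injective {n : ℕ} :
    Function.Injective (codeBindings : List (ℕ × (Fin n → ℕ)) → ℕ) := by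
  intro b b' h
  refine List.map_injective_iff.2 ?_ (Encodable.encode_injective h)
  rintro ⟨π, x⟩ ⟨π', x'⟩ h
  simp only [Prod.mk.injEq] at h
  exact Prod.ext h.1 (List.ofFn_injective h.2)

mutual

theorem PathFormula.code_inj {n m : ℕ} :
    ∀ ψ ψ' : PathFormula (Fin n) (Fin m), ψ.code = ψ'.code → ψ = ψ'
  | .atom a π, ψ', h => by
    cases ψ' <;> simp [PathFormula.code, Nat.pair_eq_pair] at h
    simp [Fin.ext h.1, h.2]
  | .nested φ π, ψ', h => by
    cases ψ' <;> simp [PathFormula.code, Nat.pair_eq_pair] at h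
    simp [StateFormula.code_inj _ _ h.1, h.2]
  | .and ψ₁ ψ₂, ψ', h => by
    cases ψ' <;> simp [PathFormula.code, Nat.pair_eq_pair] at h
    simp [PathFormula.code_inj _ _ h.1, PathFormula.code_inj _ _ h.2]
  | .neg ψ, ψ', h => by
    cases ψ' <;> simp [PathFormula.code, Nat.pair_eq_pair] at h
    simp [PathFormula.code_inj _ _ h]
  | .next ψ, ψ', h => by
    cases ψ' <;> simp [PathFormula.code, Nat.pair_eq_pair] at h
    simp [PathFormula.code_inj _ _ h]
  | .untl ψ₁ ψ₂, ψ', h => by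
    cases ψ' <;> simp [PathFormula.code, Nat.pair_eq_pair] at h
    simp [PathFormula.code_inj _ _ h.1, PathFormula.code_inj _ _ h.2]

theorem StateFormula.code_inj {n m : ℕ} :
    ∀ φ φ' : StateFormula (Fin n) (Fin m), φ.code = φ'.code → φ = φ'
  | .all x φ, φ', h => by
    cases φ' <;> simp [StateFormula.code, Nat.pair_eq_pair] at h
    simp [StateFormula.code_inj _ _ h.2, h.1]
  | .ex x φ, φ', h => by
    cases φ' <;> simp [StateFormula.code, Nat.pair_eq_pair] at h
    simp [StateFormula.code_inj _ _ h.2, h.1]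
  | .bind ψ b, φ', h => by
    cases φ' <;> simp [StateFormula.code, Nat.pair_eq_pair] at h
    simp [PathFormula.code_inj _ _ h.1, codeBindings_injective h.2]

end

/-- Different instances have different codes. -/
theorem MCInstance.code_injective {n m : ℕ} :
    Function.Injective (MCInstance.code : MCInstance n m → ℕ) := by
  rintro ⟨k, l, hl, ⟨s, t, L⟩, φ, hw, hc⟩ ⟨k', l', hl', ⟨s', t', L'⟩, φ', hw', hc'⟩ h
  have h := Encodable.encode_injective h
  simp only [Prod.mk.injEq] at h
  obtain ⟨h1, h2, h3, h4, h5, h6⟩ := h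
  subst h1 h2
  obtain rfl := StateFormula.code_inj _ _ h6
  obtain rfl := Fin.ext h3
  have ht : t = t' := by
    funext q a
    have e := congrFun (List.ofFn_injective h4) q
    have e := congrFun (List.ofFn_injective e) (finFunctionFinEquiv a)
    simpa [Fin.ext_iff] using e
  have hL : L = L' := by
    funext q
    have e := congrFun (List.ofFn_injective h5) q
    ext a
    have e := congrFun (List.ofFn_injective e) a
    simpa using e
  subst ht hL
  rfl

/-- A decision problem with instances `ι`, coded by natural numbers, and yes-instances `P` is
decidable: some algorithm answers correctly on the code of every instance. -/
def DecidableProblem {ι : Type} (code : ι → ℕ) (P : ι → Prop) : Prop :=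
  ∃ Q : ℕ → Prop, ComputablePred Q ∧ ∀ I, Q (code I) ↔ P I

/-- Model-checking instances with arbitrary finite sets of agents and of propositions. -/
abbrev AnyMCInstance : Type := Σ n : ℕ, Σ m : ℕ, MCInstance n m

/-- The code of such an instance. -/
def AnyMCInstance.code (I : AnyMCInstance) : ℕ := Nat.pair I.1 (Nat.pair I.2.1 I.2.2.code)

theorem AnyMCInstance.code_injective : Function.Injective AnyMCInstance.code := by
  rintro ⟨n, m, I⟩ ⟨n', m', I'⟩ h
  simp only [AnyMCInstance.code, Nat.pair_eq_pair] at h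
  obtain ⟨rfl, rfl, h⟩ := h
  rw [MCInstance.code_injective h]

end HyperSL

namespace HyperSL

/-! The recording game: a state is the profile of actions played last -/

-- The halting problem reduces to model checking one fixed game, in which three agents play bits and
-- the state remembers the last profile. In this game a strategy can code a number `i` (it plays `1`
-- exactly in round `i`), and it can also code a whole binary relation on numbers: agents `0` and
-- `1` announce `i` and `j` by the times at which they play `1`, and the third agent, who sees the
-- history, answers `1` iff the pair belongs to the relation (`rel_relStrat`). Quantifying over
-- strategies is thus quantifying over numbers and over binary relations.
--
-- With relation quantifiers, graphs of primitive recursive functions are definable: a value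
-- computed by recursion is certified by a relation whose pairs are each justified by the base case
-- or by an earlier pair (`GraphDefinable.prec`). So `∃ k, f n k = 0` is definable for primitive
-- recursive `f`, and such a set can encode halting.
--
-- HyperSL can state all this. Comparing the times at which `1` is played on different paths is
-- synchronous LTL, and the definitions can be made prenex, so nested state formulas are never
-- needed. The input `n` enters only as a number of `X` operators, so the formula is computable from
-- `n`.

/-- Three agents play bits; the new state stores the profile just played, and proposition `i` says
that agent `i` has just played `1`. -/
def recordGame : CGS (Fin 3) (Fin 3) (Fin (2 ^ 3)) (Fin 2) where
  init := finFunctionFinEquiv 0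
  trans _ a := finFunctionFinEquiv a
  label s := Finset.univ.filter fun i => finFunctionFinEquiv.symm s i = 1

/-- Strategies in the recording game. -/
abbrev Strat : Type := Strategy (Fin (2 ^ 3)) (Fin 2)

/-- At time `k` of the play of `f`, proposition `i` holds. -/
def Mark (i : Fin 3) (f : Fin 3 → Strat) (k : ℕ) : Prop :=
  i ∈ recordGame.label (recordGame.play recordGame.init f k)

theorem not_mark_zero (i : Fin 3) (f : Fin 3 → Strat) : ¬ Mark i f 0 := by
  simp only [Mark, CGS.play_zero, recordGame, Finset.mem_filter, Equiv.symm_apply_apply]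
  simp

/-- A label reports the round just played, so marks lag behind rounds by one; this is the source of
every `i + 1` below. -/
theorem mark_succ (i : Fin 3) (f : Fin 3 → Strat) (k : ℕ) :
    Mark i f (k + 1) ↔ f i (pref (recordGame.play recordGame.init f) k) = 1 := by
  rw [Mark, CGS.play_succ]
  simp only [recordGame, Finset.mem_filter, Equiv.symm_apply_apply, Finset.mem_univ, true_and]

-- Numbers and binary relations coded by strategies

/-- The strategy `x` represents the number `i`: played by all agents, it plays `1` exactly in
round `i`. -/
def IsNum (x : Strat) (i : ℕ) : Prop := ∀ k, Mark 0 (fun _ => x) k ↔ k = i + 1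

/-- The strategy that plays `1` exactly in round `i`. -/
def counter (i : ℕ) : Strat := fun h => if h.1.length = i + 1 then 1 else 0

theorem mark_counter {f : Fin 3 → Strat} {a : Fin 3} {i : ℕ} (h : f a = counter i) (k : ℕ) :
    Mark a f k ↔ k = i + 1 := by
  cases k with
  | zero => simp [not_mark_zero]
  | succ k => simp [mark_succ, h, counter, pref]

theorem isNum_counter (i : ℕ) : IsNum (counter i) i := mark_counter rfl

/-- Eliminates the number `i`, which a formula cannot mention: a mark occurs at some time and at no
two different times. Such a time is positive because the initial state is unmarked. -/
theorem exists_isNum_iff (x : Strat) :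
    (∃ i, IsNum x i) ↔
      (∃ k, Mark 0 (fun _ => x) k) ∧
        ¬ ∃ k, Mark 0 (fun _ => x) k ∧ ∃ l, Mark 0 (fun _ => x) (k + 1 + l) := by
  constructor
  · rintro ⟨i, h⟩
    refine ⟨⟨i + 1, (h _).2 rfl⟩, ?_⟩
    rintro ⟨k, hk, l, hl⟩
    rw [h] at hk hl
    omega
  · rintro ⟨⟨k, hk⟩, h⟩
    push Not at h
    obtain _ | k := k
    · exact absurd hk (not_mark_zero _ _)
    refine ⟨k, fun l => ⟨fun hl => ?_, fun hl => hl ▸ hk⟩⟩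
    by_contra hne
    rcases lt_or_gt_of_ne hne with hlt | hlt
    · exact h l hl (k - l) (by convert hk using 1; omega)
    · exact h _ hk (l - (k + 2)) (by convert hl using 1; omega)

/-- The binary relation represented by the strategy `r`, as a relation between the
representations of numbers. -/
def Rel (r x y : Strat) : Prop :=
  ∃ w w', (∀ k, Mark 0 ![w, w', r] k ↔ Mark 0 (fun _ => x) k) ∧
    (∀ k, Mark 1 ![w, w', r] k ↔ Mark 0 (fun _ => y) k) ∧ ∃ k, Mark 2 ![w, w', r] k

open Classical in
/-- A strategy that represents the relation `R`: it plays `1` as soon as it has seen agents `0`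
and `1` play `1` in rounds `i` and `j` with `R i j`. -/
noncomputable def relStrat (R : ℕ → ℕ → Prop) : Strat := fun h =>
  if ∃ i j, R i j ∧ (∃ s, h.1[i + 1]? = some s ∧ 0 ∈ recordGame.label s) ∧
    (∃ s, h.1[j + 1]? = some s ∧ 1 ∈ recordGame.label s) then 1 else 0

theorem pref_getElem? {X : Type} (p : ℕ → X) (j i : ℕ) (s : X) :
    (pref p j).1[i]? = some s ↔ i ≤ j ∧ p i = s := by
  simp only [pref, List.getElem?_ofFn]
  split_ifs with h
  · simp [Nat.lt_succ_iff.1 h]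
  · simp [mt Nat.lt_succ_iff.2 h]

/-- A strategy that codes a number is controlled only along the play where all agents follow it;
beside `relStrat R` it could behave differently. Hence `Rel` lets agents `0` and `1` use other
strategies and only compares their marks with those of `x` and `y`. -/
theorem rel_relStrat (R : ℕ → ℕ → Prop) {x y : Strat} {i j : ℕ} (hx : IsNum x i)
    (hy : IsNum y j) : Rel (relStrat R) x y ↔ R i j := by
  constructor
  · rintro ⟨w, w', h0, h1, k, hk⟩
    obtain _ | k := k
    · exact absurd hk (not_mark_zero _ _)
    rw [mark_succ] at hk
    simp only [Matrix.cons_val, relStrat] at hk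
    split_ifs at hk with h
    · obtain ⟨i', j', hR, ⟨s, hp, hs⟩, ⟨s', hp', hs'⟩⟩ := h
      obtain ⟨-, rfl⟩ := (pref_getElem? _ _ _ _).1 hp
      obtain ⟨-, rfl⟩ := (pref_getElem? _ _ _ _).1 hp'
      have e : i' + 1 = i + 1 := (hx _).1 ((h0 _).1 hs)
      have e' : j' + 1 = j + 1 := (hy _).1 ((h1 _).1 hs')
      obtain rfl : i' = i := by omega
      obtain rfl : j' = j := by omega
      exact hR
    · exact absurd hk (by decide)
  · intro hR
    have h0 := mark_counter (f := ![counter i, counter j, relStrat R]) (a := 0) (i := i) rfl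
    have h1 := mark_counter (f := ![counter i, counter j, relStrat R]) (a := 1) (i := j) rfl
    -- Both announcements are in the history at time `max i j + 1`; the answer given there becomes
    -- visible one step later.
    refine ⟨counter i, counter j, fun k => by rw [h0, hx k], fun k => by rw [h1, hy k],
      max i j + 1 + 1, ?_⟩
    rw [mark_succ]
    simp only [Matrix.cons_val, relStrat]
    rw [if_pos]
    exact ⟨i, j, hR, ⟨_, (pref_getElem? _ _ _ _).2 ⟨by omega, rfl⟩, (h0 _).2 rfl⟩,
      ⟨_, (pref_getElem? _ _ _ _).2 ⟨by omega, rfl⟩, (h1 _).2 rfl⟩⟩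

/-- `x` represents `0`. -/
def IsZero (x : Strat) : Prop := Mark 0 (fun _ => x) 1

/-- `y` represents the successor of the number represented by `x`. -/
def IsSucc (x y : Strat) : Prop :=
  ∀ k, Mark 0 (fun _ => x) k ↔ Mark 0 (fun _ => y) (k + 1)

theorem IsNum.isZero_iff {x : Strat} {i : ℕ} (h : IsNum x i) : IsZero x ↔ i = 0 := by
  rw [IsZero, h]
  omega

theorem IsNum.isSucc_iff {x y : Strat} {i j : ℕ} (hx : IsNum x i) (hy : IsNum y j) :
    IsSucc x y ↔ j = i + 1 := by
  simp only [IsSucc, hx _, hy _]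
  constructor
  · intro h
    have := (h (i + 1)).1 rfl
    omega
  · intro h k
    omega

theorem IsNum.same_iff {x y : Strat} {i j : ℕ} (hx : IsNum x i) (hy : IsNum y j) :
    (∀ k, Mark 0 (fun _ => x) k ↔ Mark 0 (fun _ => y) k) ↔ j = i := by
  simp only [hx _, hy _]
  constructor
  · intro h
    have := (h (i + 1)).1 rfl
    omega
  · rintro rfl k
    rfl

/-! Quantifier-free and prenex definability, uniformly in a parameter `n` -/

/-- Environments, which give a strategy for every variable. -/
abbrev Env : Type := ℕ → Strat

/-- Temporal properties of the plays of strategies in an environment, that depend on a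
parameter and on the time. -/
inductive Temporal : (ℕ → Env → ℕ → Prop) → Prop
  | atom (i : Fin 3) (t : Fin 3 → ℕ) : Temporal fun _ e k => Mark i (e ∘ t) k
  | and {T U : ℕ → Env → ℕ → Prop} : Temporal T → Temporal U →
      Temporal fun n e k => T n e k ∧ U n e k
  | not {T : ℕ → Env → ℕ → Prop} : Temporal T → Temporal fun n e k => ¬ T n e k
  | delay {T : ℕ → Env → ℕ → Prop} {c : ℕ → ℕ} : Primrec c → Temporal T →
      Temporal fun n e k => T n e (k + c n)
  | eventually {T : ℕ → Env → ℕ → Prop} : Temporal T → Temporal fun n e k => ∃ j, T n e (k + j)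

theorem Temporal.rename {T : ℕ → Env → ℕ → Prop} (h : Temporal T) (ρ : ℕ → ℕ) :
    Temporal fun n e k => T n (e ∘ ρ) k := by
  induction h with
  | atom i t => exact .atom i (ρ ∘ t)
  | and _ _ h h' => exact h.and h'
  | not _ h => exact h.not
  | delay hc _ h => exact h.delay hc
  | eventually _ h => exact h.eventually

theorem Temporal.always {T : ℕ → Env → ℕ → Prop} (h : Temporal T) :
    Temporal fun n e k => ∀ j, T n e (k + j) := by
  simpa using h.not.eventually.not

theorem Temporal.iff {T U : ℕ → Env → ℕ → Prop} (h : Temporal T) (h' : Temporal U) :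
    Temporal fun n e k => (T n e k ↔ U n e k) := by
  have := (h.and h'.not).not.and (h'.and h.not).not
  simpa only [not_and, not_not, iff_iff_implies_and_implies] using this

/-- The environment `e` with a new variable `0`, the other variables being shifted. -/
def push (s : Strat) (e : Env) : Env
  | 0 => s
  | k + 1 => e k

/-- The environment `e` with new variables `0, …, m - 1`, the other variables being shifted. -/
def pushMany (m : ℕ) (w : ℕ → Strat) (e : Env) : Env :=
  fun k => if k < m then w k else e (k - m)

/-- Prenex definable properties of environments. -/
inductive Definable : (ℕ → Env → Prop) → Prop
  | qf {T : ℕ → Env → ℕ → Prop} : Temporal T → Definable fun n e => T n e 0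
  | ex {P : ℕ → Env → Prop} : Definable P → Definable fun n e => ∃ s, P n (push s e)
  | all {P : ℕ → Env → Prop} : Definable P → Definable fun n e => ∀ s, P n (push s e)

namespace Definable

variable {P Q : ℕ → Env → Prop}

theorem rename (h : Definable P) (ρ : ℕ → ℕ) : Definable fun n e => P n (e ∘ ρ) := by
  have lift (ρ : ℕ → ℕ) (s : Strat) (e : Env) :
      push s (e ∘ ρ) = push s e ∘ fun k => Nat.casesOn k 0 fun k => ρ k + 1 := by
    funext k
    cases k <;> rfl
  induction h generalizing ρ with
  | qf hT => exact .qf (hT.rename ρ)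
  | ex _ h =>
    simp only [lift]
    exact .ex (h _)
  | all _ h =>
    simp only [lift]
    exact .all (h _)

theorem not (h : Definable P) : Definable fun n e => ¬ P n e := by
  induction h with
  | qf hT => exact .qf hT.not
  | ex _ h =>
    push Not
    exact h.all
  | all _ h =>
    push Not
    exact h.ex

/-- Prenexing: the quantifiers of one conjunct are pulled out first, then those of the other. A
conjunct that moves under a quantifier has its variables shifted by `Nat.succ`. -/
theorem and (h : Definable P) (h' : Definable Q) : Definable fun n e => P n e ∧ Q n e := by
  induction h generalizing Q with
  | qf hT =>
    rename_i T
    induction h' generalizing T with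
    | qf hU => exact .qf (hT.and hU)
    | ex _ h =>
      simp only [← exists_and_left]
      exact .ex (h (hT.rename Nat.succ))
    | all _ h =>
      simp only [← forall_and_left]
      exact .all (h (hT.rename Nat.succ))
  | ex _ h =>
    simp only [← exists_and_right]
    exact .ex (h (h'.rename Nat.succ))
  | all _ h =>
    simp only [← forall_and_right]
    exact .all (h (h'.rename Nat.succ))

theorem or (h : Definable P) (h' : Definable Q) : Definable fun n e => P n e ∨ Q n e := by
  simpa only [not_and_or, not_not] using (h.not.and h'.not).not

theorem imp (h : Definable P) (h' : Definable Q) : Definable fun n e => P n e → Q n e := by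
  simpa only [not_and, not_not] using (h.and h'.not).not

theorem forall_fin {m : ℕ} {B : Fin m → ℕ → Env → Prop} (h : ∀ i, Definable (B i)) :
    Definable fun n e => ∀ i, B i n e := by
  induction m with
  | zero =>
    -- Truth is not a primitive; it is obtained as the negation of a contradiction.
    have := Definable.qf ((Temporal.atom 0 fun _ => 0).and (Temporal.atom 0 fun _ => 0).not).not
    simpa using this
  | succ m ih =>
    simp only [Fin.forall_fin_succ]
    exact (h 0).and (ih fun i => h i.succ)

/-- The outermost of `m + 1` quantifiers supplies the variable with the largest index `m`, since
each later one shifts it. -/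
theorem exists_many (m : ℕ) (h : Definable P) :
    Definable fun n e => ∃ w, P n (pushMany m w e) := by
  induction m with
  | zero =>
    convert h using 3 with n e
    exact ⟨fun ⟨_, hw⟩ => hw, fun hw => ⟨e, hw⟩⟩
  | succ m ih =>
    convert ih.ex using 3 with n e
    constructor
    · rintro ⟨w, hw⟩
      refine ⟨w m, w, ?_⟩
      convert hw using 1
      funext k
      rcases lt_trichotomy k m with hk | rfl | hk
      · simp [pushMany, hk, Nat.lt_succ_of_lt hk]
      · simp [pushMany, push]
      · obtain ⟨l, rfl⟩ := Nat.exists_eq_add_of_lt hk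
        rw [pushMany, if_neg (by omega), show m + l + 1 - m = l + 1 by omega, pushMany,
          if_neg (by omega), show m + l + 1 - (m + 1) = l by omega]
        rfl
    · rintro ⟨s, w, hw⟩
      refine ⟨Function.update w m s, ?_⟩
      convert hw using 1
      funext k
      rcases lt_trichotomy k m with hk | rfl | hk
      · simp [pushMany, hk, Nat.lt_succ_of_lt hk, hk.ne]
      · simp [pushMany, push]
      · obtain ⟨l, rfl⟩ := Nat.exists_eq_add_of_lt hk
        rw [pushMany, if_neg (by omega), show m + l + 1 - (m + 1) = l by omega, pushMany,
          if_neg (by omega), show m + l + 1 - m = l + 1 by omega]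
        rfl

theorem isNum (a : ℕ) : Definable fun _ e => ∃ i, IsNum (e a) i := by
  simp only [exists_isNum_iff]
  have h := Temporal.atom 0 fun _ => a
  have := Definable.qf (h.eventually.and
    (h.and (h.eventually.delay (c := fun _ => 1) (.const 1))).eventually.not)
  simp only [zero_add] at this
  exact this

theorem isZero (a : ℕ) : Definable fun _ e => IsZero (e a) :=
  .qf ((Temporal.atom 0 fun _ => a).delay (c := fun _ => 0 + 1) (.const 1))

theorem isSucc (a b : ℕ) : Definable fun _ e => IsSucc (e a) (e b) := by
  have := Definable.qf ((Temporal.atom 0 fun _ => a).iff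
    ((Temporal.atom 0 fun _ => b).delay (c := fun _ => 1) (.const 1))).always
  simp only [zero_add] at this
  exact this

theorem same (a b : ℕ) :
    Definable fun _ e => ∀ k, Mark 0 (fun _ => e a) k ↔ Mark 0 (fun _ => e b) k := by
  have := Definable.qf ((Temporal.atom 0 fun _ => a).iff (Temporal.atom 0 fun _ => b)).always
  simp only [zero_add] at this
  exact this

/-- Being the number given by the parameter. -/
theorem param (a : ℕ) : Definable fun n e => Mark 0 (fun _ => e a) (n + 1) := by
  -- The only use of a delay that depends on the parameter: `n + 1` steps from the start.
  have := Definable.qf ((Temporal.atom 0 fun _ => a).delay Primrec.succ)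
  simp only [zero_add] at this
  exact this

theorem rel (r a b : ℕ) : Definable fun _ e => Rel (e r) (e a) (e b) := by
  -- The first quantified strategy, that of agent `0`, ends up with index `1`, the second with index
  -- `0`.
  have h (i : Fin 3) := Temporal.atom i ![1, 0, r + 2]
  have := Definable.ex (Definable.ex (.qf (((h 0).iff (Temporal.atom 0 fun _ => a + 2)).always.and
    (((h 1).iff (Temporal.atom 0 fun _ => b + 2)).always.and (h 2).eventually))))
  simp only [zero_add] at this
  have e (s s' : Strat) (e : Env) :
      push s (push s' e) ∘ ![1, 0, r + 2] = ![s', s, e r] := by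
    funext i
    fin_cases i <;> rfl
  simp only [e] at this
  exact this

end Definable

-- Graphs of primitive recursive functions

/-- The graph of `f` is definable, on the representations of numbers. -/
def GraphDefinable {m : ℕ} (f : List.Vector ℕ m → ℕ) : Prop :=
  ∃ P, Definable P ∧ ∀ n e y v, IsNum (e 0) y → (∀ i : Fin m, IsNum (e (i + 1)) (v.get i)) →
    (P n e ↔ y = f v)

namespace GraphDefinable

theorem comp {m k : ℕ} {f : List.Vector ℕ m → ℕ} {g : Fin m → List.Vector ℕ k → ℕ}
    (hf : GraphDefinable f) (hg : ∀ i, GraphDefinable (g i)) :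
    GraphDefinable fun a => f (List.Vector.ofFn fun i => g i a) := by
  obtain ⟨P, hP, hPf⟩ := hf
  choose G hG hGg using hg
  -- The intermediate values `g i v` are guessed as variables `0, …, m - 1`; the output then has
  -- index `m` and the arguments follow it. The two renamings feed these to the formulas for `g i`
  -- and `f`.
  refine ⟨_, Definable.exists_many m <|
    (Definable.forall_fin fun i : Fin m => Definable.isNum i).and <|
    (Definable.forall_fin fun i => (hG i).rename
      fun l => Nat.casesOn l (i : ℕ) fun l => m + (l + 1)).and
    (hP.rename fun l => Nat.casesOn l m fun l => l), ?_⟩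
  intro n e y v hy hv
  have lo (w : ℕ → Strat) (i : Fin m) : pushMany m w e i = w i := by simp [pushMany]
  have hi (w : ℕ → Strat) (l : ℕ) : pushMany m w e (m + l) = e l := by simp [pushMany]
  have key (w : ℕ → Strat) (z : Fin m → ℕ) (hw : ∀ i : Fin m, IsNum (w i) (z i)) (i : Fin m) :
      G i n (pushMany m w e ∘ fun l => Nat.casesOn l (i : ℕ) fun l => m + (l + 1)) ↔
        z i = g i v := by
    apply hGg
    · simpa [lo] using hw i
    · intro j
      simpa [hi] using hv j
  have key' (w : ℕ → Strat) (z : Fin m → ℕ) (hw : ∀ i : Fin m, IsNum (w i) (z i)) :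
      P n (pushMany m w e ∘ fun l => Nat.casesOn l m fun l => l) ↔
        y = f (List.Vector.ofFn z) := by
    apply hPf
    · simpa [hi] using hi w 0 ▸ hy
    · intro j
      simpa [lo] using hw j
  constructor
  · rintro ⟨w, h1, h2, h3⟩
    simp only [lo] at h1
    choose z hz using h1
    have e : z = fun i => g i v := funext fun i => (key w z hz i).1 (h2 i)
    rw [key' w z hz, e] at h3
    exact h3
  · intro h
    obtain ⟨w, hw⟩ : ∃ w : ℕ → Strat, ∀ i : Fin m, w i = counter (g i v) :=
      ⟨fun l => if h : l < m then counter (g ⟨l, h⟩ v) else counter 0, fun i => by simp⟩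
    have hz (i : Fin m) : IsNum (w i) (g i v) := hw i ▸ isNum_counter _
    exact ⟨w, fun i => ⟨g i v, (lo w i).symm ▸ hz i⟩, fun i => (key w _ hz i).2 rfl,
      (key' w _ hz).2 h⟩

/-- One guesses a relation `r` that relates the recursion argument to the output, such that each
pair `(x, u)` in `r` is either `(0, f …)` or follows by `g` from some pair in `r` whose first entry
is the predecessor of `x`. By induction on `x`, all pairs of `r` lie on the graph of the recursive
function; `r` need be neither functional nor total. Conversely, the full graph is such a relation.
-/
theorem prec {m : ℕ} {f : List.Vector ℕ m → ℕ} {g : List.Vector ℕ (m + 2) → ℕ}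
    (hf : GraphDefinable f) (hg : GraphDefinable g) :
    GraphDefinable fun v : List.Vector ℕ (m + 1) =>
      v.head.rec (f v.tail) fun y IH => g (y ::ᵥ IH ::ᵥ v.tail) := by
  obtain ⟨F, hF, hFf⟩ := hf
  obtain ⟨G, hG, hGg⟩ := hg
  -- Below the quantifiers over `r`, `x`, `u`, the indices are `u = 0`, `x = 1`, `r = 2`, output
  -- `3`, recursion argument `4`, parameters from `5`. Two further quantifiers, over `x'` and `u'`,
  -- shift these by two and occupy `1` and `0`, which gives `σ`.
  let ρ : ℕ → ℕ
    | 0 => 0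
    | k + 1 => k + 5
  let σ : ℕ → ℕ
    | 0 => 2
    | 1 => 1
    | 2 => 0
    | k + 3 => k + 7
  refine ⟨_, .ex <| (Definable.rel 0 2 1).and <| .all <| .all <|
    (((Definable.isNum 1).and (.isNum 0)).and (.rel 2 1 0)).imp <|
    ((Definable.isZero 1).and (hF.rename ρ)).or <|
    .ex <| .ex <| ((Definable.isNum 1).and (.isNum 0)).and <|
      (Definable.isSucc 1 3).and <| (Definable.rel 4 1 0).and (hG.rename σ), ?_⟩
  intro n e y v hy hv
  have hv0 : IsNum (e 1) v.head := by simpa using hv 0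
  have hvs (i : Fin m) : IsNum (e (i + 2)) (v.tail.get i) := by simpa using hv i.succ
  have keyF (r x u : Strat) (b : ℕ) (hu : IsNum u b) :
      F n (push u (push x (push r e)) ∘ ρ) ↔ b = f v.tail :=
    hFf _ _ _ _ hu hvs
  have keyG (r x u x' u' : Strat) (b a' b' : ℕ) (hu : IsNum u b) (hx' : IsNum x' a')
      (hu' : IsNum u' b') :
      G n (push u' (push x' (push u (push x (push r e)))) ∘ σ) ↔
        b = g (a' ::ᵥ b' ::ᵥ v.tail) := by
    refine hGg _ _ _ _ hu fun i => ?_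
    refine Fin.cases hx' (fun i => ?_) i
    refine Fin.cases hu' (fun i => ?_) i
    simp only [List.Vector.get_cons_succ]
    exact hvs i
  set h : ℕ → ℕ := fun k => Nat.rec (f v.tail) (fun y IH => g (y ::ᵥ IH ::ᵥ v.tail)) k with h_def
  change _ ↔ y = h v.head
  constructor
  · rintro ⟨r, hr, H⟩
    have main (a : ℕ) : ∀ b x u, IsNum x a → IsNum u b → Rel r x u → b = h a := by
      induction a with
      | zero =>
        intro b x u hx hu hxu
        rcases H x u ⟨⟨⟨_, hx⟩, ⟨_, hu⟩⟩, hxu⟩ with ⟨-, hf⟩ |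
          ⟨x', u', ⟨⟨a', hx'⟩, -⟩, hs, -⟩
        · exact (keyF r x u b hu).1 hf
        · exact absurd ((hx'.isSucc_iff hx).1 hs) (by omega)
      | succ a ih =>
        intro b x u hx hu hxu
        rcases H x u ⟨⟨⟨_, hx⟩, ⟨_, hu⟩⟩, hxu⟩ with ⟨hz, -⟩ |
          ⟨x', u', ⟨⟨a', hx'⟩, ⟨b', hu'⟩⟩, hs, hr', hg⟩
        · exact absurd (hx.isZero_iff.1 hz) (by omega)
        · obtain rfl : a' = a := by have := (hx'.isSucc_iff hx).1 hs; omega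
          rw [(keyG r x u x' u' b a' b' hu hx' hu').1 hg, ih b' x' u' hx' hu' hr']
    exact main _ _ _ _ hv0 hy hr
  · rintro rfl
    refine ⟨relStrat fun a b => b = h a, (rel_relStrat _ hv0 hy).2 rfl, ?_⟩
    rintro x u ⟨⟨⟨a, hx⟩, ⟨b, hu⟩⟩, hxu⟩
    have hb : b = h a := (rel_relStrat _ hx hu).1 hxu
    cases a with
    | zero => exact .inl ⟨hx.isZero_iff.2 rfl, (keyF _ x u b hu).2 hb⟩
    | succ a =>
      have hx' := isNum_counter a
      have hu' := isNum_counter (h a)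
      exact .inr ⟨_, _, ⟨⟨_, hx'⟩, ⟨_, hu'⟩⟩, (hx'.isSucc_iff hx).2 rfl,
        (rel_relStrat _ hx' hu').2 rfl, (keyG _ x u _ _ b a _ hu hx' hu').2 hb⟩

theorem of_primrec {m : ℕ} {f : List.Vector ℕ m → ℕ} (h : Nat.Primrec' f) : GraphDefinable f := by
  induction h with
  | zero => exact ⟨_, .isZero 0, fun n e y v hy _ => hy.isZero_iff⟩
  | succ =>
    refine ⟨_, .isSucc 1 0, fun n e y v hy hv => ?_⟩
    exact ((hv 0).isSucc_iff hy).trans (by rw [List.Vector.get_zero])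
  | get i => exact ⟨_, .same (i + 1) 0, fun n e y v hy hv => (hv i).same_iff hy⟩
  | comp g _ _ hf hg => exact hf.comp hg
  | prec _ _ hf hg => exact hf.prec hg

end GraphDefinable

/-! Translation of definable properties into formulas -/

/-- The triple of strategy variables that the path variable `π` stands for. -/
def triple (π : ℕ) : Fin 3 → ℕ :=
  ![π.unpair.1, π.unpair.2.unpair.1, π.unpair.2.unpair.2]

/-- Ensures that binding the path variables below `M` uses only strategy variables below `M`, so one
bound serves both. -/
theorem triple_le (π : ℕ) (i : Fin 3) : triple π i ≤ π := by
  have h1 := Nat.unpair_left_le π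
  have h2 := Nat.unpair_right_le π
  have h3 := Nat.unpair_left_le π.unpair.2
  have h4 := Nat.unpair_right_le π.unpair.2
  fin_cases i
  · exact h1
  · exact h3.trans h2
  · exact h4.trans h2

theorem triple_surjective : Function.Surjective triple := by
  intro t
  refine ⟨Nat.pair (t 0) (Nat.pair (t 1) (t 2)), ?_⟩
  funext i
  fin_cases i <;> simp [triple]

/-- `P` maps each path variable below `M` to the play of the triple it stands for. -/
def PathAssign.Interprets (P : PathAssign (Fin (2 ^ 3))) (M : ℕ) (e : Env) : Prop :=
  ∀ π < M, P π = some (recordGame.play recordGame.init (e ∘ triple π))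

theorem PathAssign.shift_zero {S : Type} (P : PathAssign S) : P.shift 0 = P := by
  have h (p : ℕ → S) : suffix p 0 = p := funext fun k => congrArg p (Nat.zero_add k)
  funext π
  simp [PathAssign.shift, h]

theorem PathAssign.shift_shift {S : Type} (P : PathAssign S) (j k : ℕ) :
    (P.shift j).shift k = P.shift (j + k) := by
  funext π
  simp only [PathAssign.shift, Option.map_map]
  congr 1
  funext p l
  simp [suffix, add_assoc]

/-- The code is again an iterate, so a number of `X` operators that varies primitive recursively
keeps the code primitive recursive. -/
theorem PathFormula.iterate_next {n m : ℕ} (ψ : PathFormula (Fin n) (Fin m)) (c : ℕ) :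
    (PathFormula.next^[c] ψ).code = (Nat.pair 4)^[c] ψ.code ∧
    ((PathFormula.next^[c] ψ).WF ↔ ψ.WF) ∧
    (PathFormula.next^[c] ψ).pathVars = ψ.pathVars := by
  induction c generalizing ψ with
  | zero => simp
  | succ c ih => simpa [PathFormula.code, PathFormula.WF, PathFormula.pathVars] using ih ψ.next

theorem PathFormula.sat_iterate_next {Agts AP S Act : Type} (G : CGS Agts AP S Act)
    (ψ : PathFormula Agts AP) (c : ℕ) (P : PathAssign S) :
    (PathFormula.next^[c] ψ).Sat G P ↔ ψ.Sat G (P.shift c) := by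
  induction c generalizing P with
  | zero =>
    rw [PathAssign.shift_zero]
    rfl
  | succ c ih =>
    rw [Function.iterate_succ_apply', PathFormula.Sat, ih, PathAssign.shift_shift, add_comm]

/-- The parameter changes only the number of `X` operators, never the path variables, so `M` can be
chosen independently of `n`. -/
theorem Temporal.exists_pathFormula {T : ℕ → Env → ℕ → Prop} (h : Temporal T) :
    ∃ ψ : ℕ → PathFormula (Fin 3) (Fin 3), Primrec (fun n => (ψ n).code) ∧
      ∃ M, ∀ n, (ψ n).WF ∧ (∀ π ∈ (ψ n).pathVars, π < M) ∧
        ∀ P e k, PathAssign.Interprets P M e → ((ψ n).Sat recordGame (P.shift k) ↔ T n e k) := by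
  induction h with
  | atom i t =>
    obtain ⟨π, rfl⟩ := triple_surjective t
    refine ⟨fun _ => .atom i π, .const _, π + 1, fun n => ⟨trivial, ?_, ?_⟩⟩
    · rintro _ rfl
      exact Nat.lt_succ_self _
    · intro P e k hP
      simp [PathFormula.Sat, PathAssign.shift, hP π (Nat.lt_succ_self _), Mark, suffix]
  | and _ _ h h' =>
    obtain ⟨ψ, hc, M, hψ⟩ := h
    obtain ⟨ψ', hc', M', hψ'⟩ := h'
    refine ⟨fun n => .and (ψ n) (ψ' n),
      Primrec₂.natPair.comp (.const 2) (Primrec₂.natPair.comp hc hc'), max M M',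
      fun n => ⟨⟨(hψ n).1, (hψ' n).1⟩, ?_, ?_⟩⟩
    · rintro π (h | h)
      · exact lt_max_of_lt_left ((hψ n).2.1 π h)
      · exact lt_max_of_lt_right ((hψ' n).2.1 π h)
    · intro P e k hP
      exact and_congr ((hψ n).2.2 P e k fun π h => hP π (lt_max_of_lt_left h))
        ((hψ' n).2.2 P e k fun π h => hP π (lt_max_of_lt_right h))
  | not _ h =>
    obtain ⟨ψ, hc, M, hψ⟩ := h
    exact ⟨fun n => .neg (ψ n), Primrec₂.natPair.comp (.const 3) hc, M,
      fun n => ⟨(hψ n).1, (hψ n).2.1, fun P e k hP => not_congr ((hψ n).2.2 P e k hP)⟩⟩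
  | @delay T c hd _ h =>
    obtain ⟨ψ, hc, M, hψ⟩ := h
    refine ⟨fun n => PathFormula.next^[c n] (ψ n), ?_, M, fun n => ⟨?_, ?_, ?_⟩⟩
    rotate_left
    · exact ((ψ n).iterate_next _).2.1.2 (hψ n).1
    · rw [((ψ n).iterate_next _).2.2]
      exact (hψ n).2.1
    · intro P e k hP
      rw [PathFormula.sat_iterate_next, PathAssign.shift_shift]
      exact (hψ n).2.2 P e _ hP
    · simp only [((ψ _).iterate_next _).1]
      exact Primrec.nat_iterate hd hc (Primrec₂.natPair.comp (.const 4) .snd)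
  | eventually _ h =>
    obtain ⟨ψ, hc, M, hψ⟩ := h
    -- The left side of the until has to be a tautology; building it from `ψ n` itself adds no path
    -- variables.
    refine ⟨fun n => .untl (.neg (.and (ψ n) (.neg (ψ n)))) (ψ n), ?_, M,
      fun n => ⟨⟨⟨(hψ n).1, (hψ n).1⟩, (hψ n).1⟩, ?_, ?_⟩⟩
    · have pair (c : ℕ) {f : ℕ → ℕ} (hf : Primrec f) := Primrec₂.natPair.comp (.const c) hf
      exact pair 5 (Primrec₂.natPair.comp
        (pair 3 (pair 2 (Primrec₂.natPair.comp hc (pair 3 hc)))) hc)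
    · rintro π ((h | h) | h) <;> exact (hψ n).2.1 π h
    · intro P e k hP
      simp only [PathFormula.Sat, PathAssign.shift_shift, and_not_self_iff, not_false_eq_true,
        implies_true, and_true]
      exact exists_congr fun j => (hψ n).2.2 P e _ hP

/-- The family `φ` of formulas, all with `L` quantifiers, expresses the property `P`, where the
free strategy variable `L + k < M` stands for the variable `k` of the environment. -/
structure Expresses (φ : ℕ → StateFormula (Fin 3) (Fin 3)) (L M : ℕ) (P : ℕ → Env → Prop) :
    Prop where
  primrec : Primrec fun n => (φ n).code
  wf : ∀ n, (φ n).WF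
  freeVars : ∀ n, ∀ x ∈ (φ n).freeVars, L ≤ x ∧ x < M
  sat : ∀ n (e : Env) (Δ : StratAssign (Fin (2 ^ 3)) (Fin 2)),
    (∀ k, L + k < M → Δ (L + k) = some (e k)) →
      ((φ n).Sat recordGame recordGame.init Δ ↔ P n e)

theorem update_push {L M : ℕ} {e : Env} {Δ : StratAssign (Fin (2 ^ 3)) (Fin 2)}
    (h : ∀ k, L + 1 + k < M → Δ (L + 1 + k) = some (e k)) (s : Strat) (k : ℕ) (hk : L + k < M) :
    Function.update Δ L (some s) (L + k) = some (push s e k) := by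
  cases k with
  | zero => simp [push]
  | succ k =>
    rw [Function.update_of_ne (by omega), show L + (k + 1) = L + 1 + k by omega]
    exact h k (by omega)

/-- Binding the strategy variable `L` uses up the environment variable `0`; the remaining ones then
start at `L + 1`, so no renaming inside `φ` is needed. -/
theorem Expresses.ex {φ : ℕ → StateFormula (Fin 3) (Fin 3)} {L M : ℕ} {P : ℕ → Env → Prop}
    (h : Expresses φ L M P) :
    Expresses (fun n => .ex L (φ n)) (L + 1) M fun n e => ∃ s, P n (push s e) where
  primrec := Primrec₂.natPair.comp (.const 1) (Primrec₂.natPair.comp (.const L) h.primrec)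
  wf := h.wf
  freeVars n x hx := ⟨((h.freeVars n x hx.1).1.lt_of_ne' hx.2), (h.freeVars n x hx.1).2⟩
  sat n _ _ hΔ := exists_congr fun s => h.sat n _ _ (update_push hΔ s)

theorem Expresses.all {φ : ℕ → StateFormula (Fin 3) (Fin 3)} {L M : ℕ} {P : ℕ → Env → Prop}
    (h : Expresses φ L M P) :
    Expresses (fun n => .all L (φ n)) (L + 1) M fun n e => ∀ s, P n (push s e) where
  primrec := Primrec₂.natPair.comp (.const 0) (Primrec₂.natPair.comp (.const L) h.primrec)
  wf := h.wf
  freeVars n x hx := ⟨((h.freeVars n x hx.1).1.lt_of_ne' hx.2), (h.freeVars n x hx.1).2⟩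
  sat n _ _ hΔ := forall_congr' fun s => h.sat n _ _ (update_push hΔ s)

/-- The path variables below `M`, bound to the triples they stand for. -/
def tripleBindings (M : ℕ) : List (ℕ × (Fin 3 → ℕ)) :=
  (List.range M).map fun π => (π, triple π)

theorem tripleBindings_fst (M : ℕ) : (tripleBindings M).map Prod.fst = List.range M := by
  simp [tripleBindings, Function.comp_def]

theorem lookup_tripleBindings {M π : ℕ} (h : π < M) :
    (tripleBindings M).lookup π = some (triple π) := by
  rw [tripleBindings]
  induction M with
  | zero => omega
  | succ M ih =>
    rw [List.range_succ, List.map_append, List.lookup_append]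
    rcases Nat.lt_succ_iff_lt_or_eq.1 h with h | rfl
    · rw [ih h]
      rfl
    · have : List.lookup π ((List.range π).map fun π => (π, triple π)) = none := by
        simp [List.lookup_eq_none_iff]
        omega
      simp [this]

theorem interprets_bindPaths {M : ℕ} {e : Env} {Δ : StratAssign (Fin (2 ^ 3)) (Fin 2)}
    (h : ∀ k < M, Δ k = some (e k)) :
    PathAssign.Interprets (recordGame.bindPaths recordGame.init Δ (tripleBindings M)) M e := by
  intro π hπ
  have hΔ (i : Fin 3) : Δ (triple π i) = some (e (triple π i)) :=
    h _ ((triple_le π i).trans_lt hπ)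
  simp only [CGS.bindPaths, lookup_tripleBindings hπ, Option.bind_some, StratAssign.profile]
  rw [dif_pos (by simp [hΔ])]
  simp only [hΔ, Option.get_some, Option.map_some]
  rfl

theorem Definable.exists_expresses {P : ℕ → Env → Prop} (h : Definable P) :
    ∃ φ L M, Expresses φ L M P := by
  induction h with
  | qf hT =>
    obtain ⟨ψ, hc, M, hψ⟩ := hT.exists_pathFormula
    refine ⟨fun n => .bind (ψ n) (tripleBindings M), 0, M, ?_, fun n => ⟨(hψ n).1, ?_, ?_⟩,
      ?_, ?_⟩
    · exact Primrec₂.natPair.comp (.const 2) (Primrec₂.natPair.comp hc (.const _))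
    · rw [tripleBindings_fst]
      exact List.nodup_range
    · rw [tripleBindings_fst]
      exact fun π hπ => List.mem_range.2 ((hψ n).2.1 π hπ)
    · rintro n x ⟨p, hp, i, rfl⟩
      obtain ⟨π, hπ, rfl⟩ := List.mem_map.1 hp
      exact ⟨Nat.zero_le _, (triple_le π i).trans_lt (List.mem_range.1 hπ)⟩
    · intro n e Δ hΔ
      simp only [zero_add] at hΔ
      have := (hψ n).2.2 _ e 0 (interprets_bindPaths hΔ)
      -- Removes the shift by `0`, as zero applications of `X`.
      rwa [← PathFormula.sat_iterate_next] at this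
  | ex _ h =>
    obtain ⟨φ, L, M, h⟩ := h
    exact ⟨_, _, _, h.ex⟩
  | all _ h =>
    obtain ⟨φ, L, M, h⟩ := h
    exact ⟨_, _, _, h.all⟩

/-- A definable property that does not depend on the environment is expressed by closed
formulas. -/
theorem Definable.exists_closed {R : ℕ → Prop} (h : Definable fun n _ => R n) :
    ∃ φ : ℕ → StateFormula (Fin 3) (Fin 3), Primrec (fun n => (φ n).code) ∧
      ∀ n, (φ n).WF ∧ (φ n).Closed ∧ (recordGame.Models (φ n) ↔ R n) := by
  obtain ⟨φ, L, M, h⟩ := h.exists_expresses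
  -- Vacuous quantifiers raise the lower bound on the free variables; after `M` of them no index is
  -- left below `M`.
  have pad (d : ℕ) : ∃ φ', Expresses φ' (L + d) M fun n _ => R n := by
    induction d with
    | zero => exact ⟨φ, h⟩
    | succ d ih =>
      obtain ⟨φ', h'⟩ := ih
      have := h'.ex
      simp only [exists_const] at this
      exact ⟨_, this⟩
  obtain ⟨φ', h'⟩ := pad M
  refine ⟨φ', h'.primrec, fun n => ⟨h'.wf n, ?_, ?_⟩⟩
  · refine Set.eq_empty_of_forall_notMem fun x hx => ?_
    have := h'.freeVars n x hx
    omega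
  · exact h'.sat n (fun _ => counter 0) _ fun k hk => by omega

/-! Undecidability -/

/-- Three numbers are quantified: the value `0`, the input `n`, pinned down by `Definable.param`,
and the witness `k`, at indices `0`, `1`, `2`, as the graph of `f` expects. -/
theorem definable_exists_of_primrec {f : ℕ → ℕ → ℕ} (hf : Primrec₂ f) :
    Definable fun n _ => ∃ k, f n k = 0 := by
  obtain ⟨P, hP, hPf⟩ := GraphDefinable.of_primrec (Nat.Primrec'.prim_iff₂.2 hf)
  have := Definable.ex <| .ex <| .ex <| ((Definable.isNum 0).and <| (Definable.isNum 1).and <|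
    Definable.isNum 2).and <| (Definable.isZero 0).and <| (Definable.param 1).and hP
  convert this using 3 with n e
  constructor
  · rintro ⟨k, hk⟩
    have h0 := isNum_counter 0
    have hn := isNum_counter n
    have hk' := isNum_counter k
    refine ⟨counter k, counter n, counter 0, ⟨⟨_, h0⟩, ⟨_, hn⟩, ⟨_, hk'⟩⟩, h0.isZero_iff.2 rfl,
      (hn _).2 rfl, (hPf n (push (counter 0) (push (counter n) (push (counter k) e)))
        0 (n ::ᵥ k ::ᵥ .nil) h0 ?_).2 hk.symm⟩
    intro i
    fin_cases i
    exacts [hn, hk']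
  · rintro ⟨x, y, z, ⟨⟨c, hz⟩, ⟨b, hy⟩, ⟨a, hx⟩⟩, hz0, hyn, hp⟩
    have hb := (hy _).1 hyn
    obtain rfl : c = 0 := hz.isZero_iff.1 hz0
    obtain rfl : n = b := by omega
    refine ⟨a, ((hPf _ _ 0 (n ::ᵥ a ::ᵥ .nil) hz ?_).1 hp).symm⟩
    intro i
    fin_cases i
    exacts [hy, hx]

theorem exists_primrec_not_computable :
    ∃ f : ℕ → ℕ → ℕ, Primrec₂ f ∧ ¬ ComputablePred fun n => ∃ k, f n k = 0 := by
  open Nat.Partrec.Code in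
  -- `g n k` vanishes iff the program with code `n`, run on input `0` with bound `k`, returns a
  -- value.
  let g : ℕ → ℕ → ℕ := fun n k =>
    Option.casesOn (evaln k (Denumerable.ofNat Nat.Partrec.Code n) 0) 1 fun _ => 0
  have hg : Primrec₂ g := by
    have h : Primrec fun p : ℕ × ℕ =>
        evaln p.2 (Denumerable.ofNat Nat.Partrec.Code p.1) 0 :=
      primrec_evaln.comp (.pair (.pair .snd ((Primrec.ofNat _).comp .fst)) (.const 0))
    exact Primrec.option_casesOn h (.const 1) (Primrec₂.const 0)
  refine ⟨g, hg, fun h => ComputablePred.halting_problem 0 ?_⟩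
  obtain ⟨_, h⟩ := h
  refine ⟨Classical.decPred _, ?_⟩
  refine (h.comp (Computable.encode (α := Nat.Partrec.Code))).of_eq fun c => ?_
  refine decide_eq_decide.2 ?_
  simp only [g, Denumerable.ofNat_encode, Part.dom_iff_mem, evaln_complete]
  rw [exists_comm]
  refine exists_congr fun k => ?_
  cases evaln k c 0 <;> simp

/-- The game is constant and the formula has a primitive recursive code, so mapping `n` to the code
of its instance is a many-one reduction. -/
theorem not_decidable_three : ¬ DecidableProblem
    (MCInstance.code : MCInstance 3 3 → ℕ) MCInstance.Holds := by
  rintro ⟨Q, ⟨_, hQ⟩, H⟩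
  obtain ⟨f, hf, hn⟩ := exists_primrec_not_computable
  obtain ⟨φ, hc, hφ⟩ := (definable_exists_of_primrec hf).exists_closed
  let I (n : ℕ) : MCInstance 3 3 :=
    ⟨2 ^ 3, 2, by decide, recordGame, φ n, (hφ n).1, (hφ n).2.1⟩
  have hI : Primrec fun n => (I n).code := by
    exact Primrec.encode.comp (.pair (.const (2 ^ 3)) (.pair (.const 2)
      (.pair (.const (recordGame.init : ℕ)) (.pair (.const recordGame.transTable)
      (.pair (.const recordGame.labelTable) hc)))))
  refine hn ⟨Classical.decPred _, (hQ.comp hI.to_comp).of_eq fun n => decide_eq_decide.2 ?_⟩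
  exact (H (I n)).trans (hφ n).2.2

theorem DecidableProblem.fixed {n m : ℕ}
    (h : DecidableProblem AnyMCInstance.code (fun I => I.2.2.Holds)) :
    DecidableProblem (MCInstance.code : MCInstance n m → ℕ) MCInstance.Holds := by
  obtain ⟨Q, ⟨_, hQ⟩, H⟩ := h
  refine ⟨fun c => Q (Nat.pair n (Nat.pair m c)), ⟨inferInstance, hQ.comp ?_⟩,
    fun I => H ⟨n, m, I⟩⟩
  exact (Primrec₂.natPair.comp (.const n) (Primrec₂.natPair.comp (.const m) .id)).to_comp

end HyperSL

/-- Model checking of HyperSL is undecidable: with the agents and the propositions as part of the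
input, and also for some fixed finite sets of agents and propositions. -/
theorem mainTheorem4 :
    ¬ HyperSL.DecidableProblem HyperSL.AnyMCInstance.code (fun I => I.2.2.Holds) ∧
    ∃ n m : ℕ, ¬ HyperSL.DecidableProblem
      (HyperSL.MCInstance.code : HyperSL.MCInstance n m → ℕ) HyperSL.MCInstance.Holds :=
  ⟨fun h => HyperSL.not_decidable_three h.fixed, 3, 3, HyperSL.not_decidable_three⟩
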